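/- **Conventions.** Let $[n]=\{0,1,\dots,n\}$ with base point $0$, and let $\Gamma^{op}$ be the category of the pointed sets $[n]$ ($n\ge 0$) and pointed maps. Identify $[n]\wedge[m]$ with $[nm]$ by the inverse lexicographical order. A *$\Gamma$-ring* $R$ is a functor from $\Gamma^{op}$ to pointed simplicial sets with $R[0]$ a point, together with a unit $\eta:[n]\to R[n]$ and an associative and unital multiplication $R[n]\wedge R[m]\to R([n]\wedge[m])=R[nm]$, natural in $[n]$ and $[m]$; it is *discrete* if it takes values in pointed sets. The $d$-simplices of the $R[n]$ form a discrete $\Gamma$-ring $R_d$. Write $1=\eta(1)\in R_d[1]$ and write $0$ for base points; the products of $a\in R_d[1]$ and $x\in R_d[n]$ lie in $R_d[n]$, and $x^k\in R_d[n^k]$. The discrete $\Gamma$-ring $H\mathbf Z$ has $H\mathbf Z[n]=\tilde{\mathbf Z}[n]\cong\mathbf Z^n$, the reduced free abelian group on $[n]$, with unit the inclusion of the generators and $(\sum a_i i)(\sum b_j j)=\sum a_ib_j\,(i\wedge j)$. Multiplicative maps are natural transformations compatible with units and multiplications. For a pointed map $f$ write $f$ also for the map it induces. Let $p^n_i:[n]\to[n-1]$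 send $i$ to $0$ and be otherwise the order preserving bijection, let $d^n_j:[n-1]\to[n]$ be the order preserving injection missing $j$, and for $i<j$ let $s^n_{i,j,l}:[n]\to[n-1]$ send $i,j$ to $l$ and the other elements bijectively and in order onto $[n-1]\setminus\{l\}$ (all indices are nonzero). Let $A_+$ and $A_-\subset\{1,\dots,2^k\}$ be the sets of coordinates at which $(1,-1)^k\in H\mathbf Z[2^k]$ is $1$ and $-1$, respectively. A *formal difference law* in a discrete $\Gamma$-ring $Q$ is an element $r\in Q[2]$ such that 1. $p^2_2(r)=1$ and $s^2_{1,2,1}(r)=0$; 2. $p^2_1(r)\,r=r\,p^2_1(r)=\sigma(r)$, where $\sigma$ transposes $1$ and $2$; 3. for all $k$, $r^k\in Q[2^k]$ is fixed by all permutations of $\{1,\dots,2^k\}$ that preserve $A_+$ and $A_-$; 4. for all $k$, all $i<j$ in $\{1,\dots,2^k\}$ one of which lies in $A_+$ and the other in $A_-$, and all $l\in\{1,\dots,2^k-1\}$, $\;s^{2^k}_{i,j,l}(r^k)=d^{2^k-1}_l\,p^{2^k-1}_i\,p^{2^k}_j(r^k)$. For a $\Gamma$-ring $R$ let $FDL(R)$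 be the simplicial set whose $d$-simplices are the formal difference laws in $R_d$, let $\Gamma(H\mathbf Z,R)$ be the simplicial set whose $d$-simplices are the multiplicative maps $H\mathbf Z\to R_d$, and let $G_*$ be the simplicial group whose $d$-simplices are the invertible elements of the monoid $R_d[1]$. It acts on both simplicial sets by conjugation: $r\mapsto grg^{-1}$ and $\varphi\mapsto(x\mapsto g\,\varphi(x)\,g^{-1})$. For a simplicial set $X$ with an action of $G_*$, the homotopy orbits are the simplicial set $X_{hG_*}=EG_*\times_{G_*}X$, the quotient of $EG_*\times X$ by the diagonal action, where $(EG_*)_d=G_d^{\,d+1}$, with $\theta^*(h_i)_i=(\theta^*h_{\theta(i)})_i$ and $G_d$ acting by left multiplication. **Theorem 3.9.** For every $\Gamma$-ring $R$ the simplicial sets $FDL(R)_{hG_*}$ and $\Gamma(H\mathbf Z,R)_{hG_*}$ are isomorphic. More precisely, there is an isomorphism $FDL(R)_{hG_*}\cong\Gamma(H\mathbf Z,R)_{hG_*}$ of simplicial sets that sends the class of $(h,r)$, for $h\in(EG_*)_d$ and $r\in FDL(R)_d$, to the class of $(h,\varphi)$ for a multiplicative map $\varphi:H\mathbf Z\to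 R_d$ with $\varphi(1,-1)=r$. -/

import Mathlib

open CategoryTheory

universe u v w

/-- A pointed map `[n] ⟶ [m]`, where `[n] = {0, 1, ..., n}` has base point `0`. -/
@[ext]
structure PMap (n m : ℕ) where
  toFun : Fin (n + 1) → Fin (m + 1)
  map_zero : toFun 0 = 0

namespace PMap

def id (n : ℕ) : PMap n n := ⟨fun a => a, rfl⟩

def comp {n m k : ℕ} (g : PMap m k) (f : PMap n m) : PMap n k :=
  ⟨fun a => g.toFun (f.toFun a), by rw [f.map_zero, g.map_zero]⟩

/-- The identity `[n] = [m]` when `n = m`. -/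
def cast {n m : ℕ} (h : n = m) : PMap n m :=
  ⟨Fin.cast (by rw [h]), by subst h; rfl⟩

/-- The pointed bijection of `[n]` given by a permutation of `{1, ..., n}`.
Here and below `a : Fin n` stands for the element `a.succ = a + 1` of `{1, ..., n}`. -/
def perm {n : ℕ} (π : Equiv.Perm (Fin n)) : PMap n n :=
  ⟨Fin.cases 0 (fun a => (π a).succ), rfl⟩

/-- `p_i^n : [n] ⟶ [n-1]` sends the element `i` to the base point and is otherwise the
order preserving bijection (the index `i : Fin n` stands for the element `i + 1`). -/
def p (n : ℕ) (i : Fin n) : PMap n (n - 1) :=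
  ⟨fun a => ⟨if a.1 < i.1 + 1 then a.1 else if a.1 = i.1 + 1 then 0 else a.1 - 1, by
      have := a.2; have := i.2; split_ifs <;> omega⟩,
    by apply Fin.ext; simp⟩

/-- `d_j^n : [n-1] ⟶ [n]` is the order preserving injection missing the element `j`
(the index `j : Fin n` stands for the element `j + 1`). -/
def d (n : ℕ) (j : Fin n) : PMap (n - 1) n :=
  ⟨fun a => ⟨if a.1 < j.1 + 1 then a.1 else a.1 + 1, by
      have := a.2; have := j.2; split_ifs <;> omega⟩,
    by apply Fin.ext; simp⟩

/-- `s_{i,j,k}^n : [n] ⟶ [n-1]`, for `i < j`, sends the elements `i` and `j` to `k` and maps the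
other elements bijectively, preserving the order, onto `[n-1] \ {k}`. (Again the indices `i`, `j`,
`k` stand for the elements `i + 1`, `j + 1`, `k + 1`. An element `a` different from `i`, `j` has
`t` elements of `[n] \ {i, j}` below it, and goes to the element of `[n-1] \ {k}` with
this property.) -/
def s (n : ℕ) (i j : Fin n) (hij : i < j) (k : Fin (n - 1)) : PMap n (n - 1) :=
  ⟨fun a => ⟨
      if a.1 = i.1 + 1 ∨ a.1 = j.1 + 1 then k.1 + 1 else
        let t := a.1 - (if i.1 + 1 < a.1 then 1 else 0) - (if j.1 + 1 < a.1 then 1 else 0)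
        if t < k.1 + 1 then t else t + 1, by
      have := a.2; have := k.2; have := j.2; have h : i.1 < j.1 := hij
      dsimp only
      split_ifs <;> omega⟩,
    by apply Fin.ext; simp⟩

end PMap

/-- The inverse lexicographical order identifies the elements `i ∧ j` different from the base point
of `[n] ∧ [m]` with `{1, ..., nm}`; with indices starting from `0` it is `(i, j) ↦ i + n * j`. -/
def smashEquiv (n m : ℕ) : Fin n × Fin m ≃ Fin (n * m) :=
  (Equiv.prodComm _ _).trans (finProdFinEquiv.trans (finCongr (Nat.mul_comm m n)))

theorem smashEquiv_val (n m : ℕ) (x : Fin n × Fin m) :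
    (smashEquiv n m x).1 = x.1.1 + n * x.2.1 := rfl

/-- The projection `[n] × [m] → [n] ∧ [m] = [nm]`. -/
def smashIdx (n m : ℕ) (i : Fin (n + 1)) (j : Fin (m + 1)) : Fin (n * m + 1) :=
  Fin.cases 0 (fun a => Fin.cases 0 (fun b => (smashEquiv n m (a, b)).succ) j) i

/-- The smash product `f ∧ g : [nm] = [n] ∧ [m] ⟶ [n'] ∧ [m'] = [n'm']` of pointed maps. -/
def PMap.smash {n m n' m' : ℕ} (f : PMap n n') (g : PMap m m') : PMap (n * m) (n' * m') :=
  ⟨Fin.cases 0 (fun c => smashIdx n' m' (f.toFun ((smashEquiv n m).symm c).1.succ)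
      (g.toFun ((smashEquiv n m).symm c).2.succ)), rfl⟩

theorem smashIdx_zero_left (n m : ℕ) (j : Fin (m + 1)) : smashIdx n m 0 j = 0 := rfl

theorem smashIdx_zero_right (n m : ℕ) (i : Fin (n + 1)) : smashIdx n m i 0 = 0 := by
  induction i using Fin.cases <;> rfl

theorem smashIdx_succ (n m : ℕ) (a : Fin n) (b : Fin m) :
    smashIdx n m a.succ b.succ = (smashEquiv n m (a, b)).succ := rfl

theorem PMap.smash_smashIdx {n m n' m' : ℕ} (f : PMap n n') (g : PMap m m')
    (i : Fin (n + 1)) (j : Fin (m + 1)) :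
    (f.smash g).toFun (smashIdx n m i j) = smashIdx n' m' (f.toFun i) (g.toFun j) := by
  induction i using Fin.cases with
  | zero => rw [smashIdx_zero_left, f.map_zero, smashIdx_zero_left, PMap.map_zero]
  | succ a =>
    induction j using Fin.cases with
    | zero => rw [smashIdx_zero_right, g.map_zero, smashIdx_zero_right, PMap.map_zero]
    | succ b =>
      rw [smashIdx_succ]
      change smashIdx n' m' (f.toFun ((smashEquiv n m).symm (smashEquiv n m (a, b))).1.succ)
        (g.toFun ((smashEquiv n m).symm (smashEquiv n m (a, b))).2.succ) = _
      rw [Equiv.symm_apply_apply]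

/-- The category `Γ^op`: the full subcategory of pointed sets with objects all `[n]`. -/
structure GammaOp where
  len : ℕ

instance : Category GammaOp where
  Hom a b := PMap a.len b.len
  id a := PMap.id a.len
  comp f g := PMap.comp g f

/-! ### Discrete `Γ`-rings -/

/-- A discrete `Γ`-space: a functor `F` from `Γ^op` to pointed sets with `F[0]` a point. -/
structure DiscreteGammaSpace where
  functor : GammaOp ⥤ Pointed.{u}
  zero : Subsingleton (functor.obj ⟨0⟩)

namespace DiscreteGammaSpace

/-- The set `F[n]`. -/
abbrev El (F : DiscreteGammaSpace.{u}) (n : ℕ) : Type u := F.functor.obj ⟨n⟩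

/-- The base point of `F[n]`. -/
def pt (F : DiscreteGammaSpace.{u}) (n : ℕ) : F.El n := (F.functor.obj ⟨n⟩).point

/-- The map `F[n] → F[m]` induced by a pointed map `[n] ⟶ [m]`. -/
def act (F : DiscreteGammaSpace.{u}) {n m : ℕ} (f : PMap n m) (x : F.El n) : F.El m :=
  (F.functor.map (X := ⟨n⟩) (Y := ⟨m⟩) f).toFun x

theorem act_id (F : DiscreteGammaSpace.{u}) {n : ℕ} (x : F.El n) : F.act (PMap.id n) x = x :=
  congrFun (congrArg Pointed.Hom.toFun (F.functor.map_id ⟨n⟩)) x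

theorem act_comp (F : DiscreteGammaSpace.{u}) {n m k : ℕ} (g : PMap m k) (f : PMap n m)
    (x : F.El n) : F.act (g.comp f) x = F.act g (F.act f x) :=
  congrFun (congrArg Pointed.Hom.toFun
    (F.functor.map_comp (X := ⟨n⟩) (Y := ⟨m⟩) (Z := ⟨k⟩) f g)) x

theorem act_pt (F : DiscreteGammaSpace.{u}) {n m : ℕ} (f : PMap n m) :
    F.act f (F.pt n) = F.pt m :=
  (F.functor.map (X := ⟨n⟩) (Y := ⟨m⟩) f).map_point

end DiscreteGammaSpace

/-- A discrete `Γ`-ring: a discrete `Γ`-space `F` with a unit `η : 𝐒 → F`, where `𝐒[n] = [n]`, and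
a multiplication `F ∧ F → F`, given by maps `F[n] ∧ F[m] → F([n] ∧ [m]) = F[nm]` natural in `[n]`
and `[m]`, which is associative and unital. -/
structure DiscreteGammaRing extends DiscreteGammaSpace.{u} where
  unit : ∀ n : ℕ, Fin (n + 1) → toDiscreteGammaSpace.El n
  unit_zero : ∀ n : ℕ, unit n 0 = toDiscreteGammaSpace.pt n
  unit_nat : ∀ {n m : ℕ} (f : PMap n m) (a : Fin (n + 1)),
    toDiscreteGammaSpace.act f (unit n a) = unit m (f.toFun a)
  mul : ∀ {n m : ℕ}, toDiscreteGammaSpace.El n → toDiscreteGammaSpace.El m →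
    toDiscreteGammaSpace.El (n * m)
  pt_mul : ∀ {n m : ℕ} (y : toDiscreteGammaSpace.El m),
    mul (toDiscreteGammaSpace.pt n) y = toDiscreteGammaSpace.pt (n * m)
  mul_pt : ∀ {n m : ℕ} (x : toDiscreteGammaSpace.El n),
    mul x (toDiscreteGammaSpace.pt m) = toDiscreteGammaSpace.pt (n * m)
  mul_nat : ∀ {n m n' m' : ℕ} (f : PMap n n') (g : PMap m m')
    (x : toDiscreteGammaSpace.El n) (y : toDiscreteGammaSpace.El m),
    toDiscreteGammaSpace.act (f.smash g) (mul x y) =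
      mul (toDiscreteGammaSpace.act f x) (toDiscreteGammaSpace.act g y)
  mul_assoc : ∀ {n m k : ℕ} (x : toDiscreteGammaSpace.El n) (y : toDiscreteGammaSpace.El m)
    (z : toDiscreteGammaSpace.El k),
    toDiscreteGammaSpace.act (PMap.cast (Nat.mul_assoc n m k)) (mul (mul x y) z) =
      mul x (mul y z)
  one_mul : ∀ {n : ℕ} (x : toDiscreteGammaSpace.El n),
    toDiscreteGammaSpace.act (PMap.cast (Nat.one_mul n)) (mul (unit 1 1) x) = x
  mul_one : ∀ {n : ℕ} (x : toDiscreteGammaSpace.El n),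
    toDiscreteGammaSpace.act (PMap.cast (Nat.mul_one n)) (mul x (unit 1 1)) = x

namespace DiscreteGammaRing

/-- The element `1` of `R[1]`. -/
def one (R : DiscreteGammaRing.{u}) : R.El 1 := R.unit 1 1

/-- The product `a x ∈ R([1] ∧ [n]) = R[n]` of `a ∈ R[1]` and `x ∈ R[n]`. -/
def lmul (R : DiscreteGammaRing.{u}) {n : ℕ} (a : R.El 1) (x : R.El n) : R.El n :=
  R.act (PMap.cast (Nat.one_mul n)) (R.mul a x)

/-- The product `x a ∈ R([n] ∧ [1]) = R[n]` of `x ∈ R[n]` and `a ∈ R[1]`. -/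
def rmul (R : DiscreteGammaRing.{u}) {n : ℕ} (x : R.El n) (a : R.El 1) : R.El n :=
  R.act (PMap.cast (Nat.mul_one n)) (R.mul x a)

/-- The power `x^k ∈ R[n^k]` of `x ∈ R[n]`. -/
def pow (R : DiscreteGammaRing.{u}) {n : ℕ} (x : R.El n) : (k : ℕ) → R.El (n ^ k)
  | 0 => R.one
  | k + 1 => R.mul (R.pow x k) x

/-- Multiplicative maps `R → R'` of discrete `Γ`-rings: natural transformations of functors to
pointed sets which are compatible with the units and the multiplications. -/
@[ext]
structure Hom (R : DiscreteGammaRing.{u}) (R' : DiscreteGammaRing.{v}) where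
  app : ∀ n : ℕ, R.El n → R'.El n
  app_pt : ∀ n : ℕ, app n (R.pt n) = R'.pt n
  app_act : ∀ {n m : ℕ} (f : PMap n m) (x : R.El n), app m (R.act f x) = R'.act f (app n x)
  app_unit : ∀ (n : ℕ) (a : Fin (n + 1)), app n (R.unit n a) = R'.unit n a
  app_mul : ∀ {n m : ℕ} (x : R.El n) (y : R.El m),
    app (n * m) (R.mul x y) = R'.mul (app n x) (app m y)

def Hom.id (R : DiscreteGammaRing.{u}) : Hom R R where
  app _ x := x
  app_pt _ := rfl
  app_act _ _ := rfl
  app_unit _ _ := rfl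
  app_mul _ _ := rfl

def Hom.comp {R : DiscreteGammaRing.{u}} {R' : DiscreteGammaRing.{v}}
    {R'' : DiscreteGammaRing.{w}} (g : Hom R' R'') (f : Hom R R') : Hom R R'' where
  app n x := g.app n (f.app n x)
  app_pt n := by rw [f.app_pt, g.app_pt]
  app_act h x := by rw [f.app_act, g.app_act]
  app_unit n a := by rw [f.app_unit, g.app_unit]
  app_mul x y := by rw [f.app_mul, g.app_mul]

end DiscreteGammaRing

/-! ### The `Γ`-ring `Hℤ` -/

/-- The reduced free abelian group on `[n]` is `Fin n → ℤ`: the `n`-tuple `a` stands for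
`∑ a_i i`, where `i` runs through `{1, ..., n}`. This is the map induced by a pointed map `f`,
`∑ a_i i ↦ ∑ a_i f(i)`, where the base point is set to `0`. -/
def HZpush {n m : ℕ} (f : PMap n m) (a : Fin n → ℤ) : Fin m → ℤ :=
  fun j => ∑ i : Fin n, if f.toFun i.succ = j.succ then a i else 0

/-- The coefficient of an `n`-tuple at an element of `[n]`, being `0` at the base point. -/
def HZext {n : ℕ} (a : Fin n → ℤ) : Fin (n + 1) → ℤ := Fin.cases 0 a

theorem HZpush_sum {n m : ℕ} (f : PMap n m) (a : Fin n → ℤ) (φ : Fin (m + 1) → ℤ)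
    (h0 : φ 0 = 0) :
    ∑ j : Fin m, HZpush f a j * φ j.succ = ∑ i : Fin n, a i * φ (f.toFun i.succ) := by
  simp only [HZpush, Finset.sum_mul]
  rw [Finset.sum_comm]
  refine Finset.sum_congr rfl fun i _ => ?_
  generalize f.toFun i.succ = t
  induction t using Fin.cases with
  | zero =>
    rw [h0, mul_zero]
    refine Finset.sum_eq_zero fun j _ => ?_
    rw [if_neg (Fin.succ_ne_zero j).symm, zero_mul]
  | succ t =>
    rw [Finset.sum_eq_single t]
    · simp
    · intro b _ hb
      rw [if_neg (fun h => hb (Fin.succ_injective _ h).symm), zero_mul]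
    · simp

/-- Two tuples agree if all weighted sums over them agree. -/
theorem HZ_ext {n : ℕ} {a b : Fin n → ℤ}
    (h : ∀ φ : Fin (n + 1) → ℤ, φ 0 = 0 →
      ∑ i : Fin n, a i * φ i.succ = ∑ i : Fin n, b i * φ i.succ) : a = b := by
  funext i
  have := h (fun t => if t = i.succ then 1 else 0) (by simp [(Fin.succ_ne_zero i).symm])
  simpa using this

/-- The functor `[n] ↦ ℤ̃[n]` to pointed sets. -/
def HZfunctor : GammaOp ⥤ Pointed.{0} where
  obj n := ⟨Fin n.len → ℤ, 0⟩
  map {n m} f := ⟨HZpush (n := n.len) (m := m.len) f, by funext j; simp [HZpush]⟩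
  map_id n := by
    apply Pointed.Hom.ext
    funext a
    refine HZ_ext (n := n.len) fun φ h0 => ?_
    exact HZpush_sum (PMap.id n.len) a φ h0
  map_comp {n m k} f g := by
    apply Pointed.Hom.ext
    funext a
    refine HZ_ext (n := k.len) fun φ h0 => ?_
    refine (HZpush_sum (PMap.comp g f) a φ h0).trans ?_
    refine Eq.trans ?_ (HZpush_sum (n := m.len) (m := k.len) g (HZpush f a) φ h0).symm
    refine (HZpush_sum (n := n.len) (m := m.len) f a (fun t => φ (PMap.toFun g t)) ?_).symm
    rw [PMap.map_zero g, h0]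

def HZspace : DiscreteGammaSpace.{0} where
  functor := HZfunctor
  zero := ⟨fun _ _ => funext fun i : Fin 0 => i.elim0⟩

/-- The product `(∑ a_i i) ∧ (∑ b_j j) = ∑ a_i b_j (i ∧ j)`. -/
def HZmul {n m : ℕ} (a : Fin n → ℤ) (b : Fin m → ℤ) : Fin (n * m) → ℤ :=
  fun c => a ((smashEquiv n m).symm c).1 * b ((smashEquiv n m).symm c).2

theorem HZmul_sum {n m : ℕ} (a : Fin n → ℤ) (b : Fin m → ℤ) (φ : Fin (n * m + 1) → ℤ) :
    ∑ c : Fin (n * m), HZmul a b c * φ c.succ =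
      ∑ i : Fin n, a i * ∑ j : Fin m, b j * φ (smashIdx n m i.succ j.succ) := by
  rw [← (smashEquiv n m).sum_comp, Fintype.sum_prod_type]
  refine Finset.sum_congr rfl fun i _ => ?_
  rw [Finset.mul_sum]
  refine Finset.sum_congr rfl fun j _ => ?_
  simp [HZmul, smashIdx_succ, mul_assoc]

/-- The `Γ`-ring `Hℤ`; the unit is the embedding of the generators. -/
def HZ : DiscreteGammaRing.{0} where
  toDiscreteGammaSpace := HZspace
  unit n a := fun i : Fin n => if a = i.succ then 1 else 0
  unit_zero n := by
    funext i
    exact if_neg (Fin.succ_ne_zero (n := n) i).symm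
  unit_nat {n m} f a := by
    refine HZ_ext (n := m) fun φ h0 => ?_
    refine (HZpush_sum f _ φ h0).trans ?_
    have key : ∀ (l : ℕ) (ψ : Fin (l + 1) → ℤ) (t : Fin (l + 1)), ψ 0 = 0 →
        ∑ i : Fin l, (if t = i.succ then (1 : ℤ) else 0) * ψ i.succ = ψ t := by
      intro l ψ t hψ
      induction t using Fin.cases with
      | zero =>
        rw [hψ]
        exact Finset.sum_eq_zero fun i _ => by rw [if_neg (Fin.succ_ne_zero i).symm, zero_mul]
      | succ t => simp
    rw [key m φ _ h0]
    exact key n (fun t => φ (f.toFun t)) a (by rw [f.map_zero, h0])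
  mul {n m} a b := HZmul (n := n) (m := m) a b
  pt_mul {n m} y := by funext c; exact zero_mul _
  mul_pt {n m} x := by funext c; exact mul_zero _
  mul_nat {n m n' m'} f g x y := by
    refine HZ_ext (n := n' * m') fun φ h0 => ?_
    refine (HZpush_sum (f.smash g) (HZmul (n := n) (m := m) x y) φ h0).trans ?_
    refine (HZmul_sum (n := n) (m := m) x y (fun t => φ ((f.smash g).toFun t))).trans ?_
    refine Eq.trans ?_ (HZmul_sum (HZpush f x) (HZpush g y) φ).symm
    simp only [PMap.smash_smashIdx]
    have h1 : ∀ i : Fin n',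
        ∑ j : Fin m', HZpush g y j * φ (smashIdx n' m' i.succ j.succ) =
        ∑ j : Fin m, y j * φ (smashIdx n' m' i.succ (g.toFun j.succ)) := fun i =>
      HZpush_sum g y (fun t => φ (smashIdx n' m' i.succ t)) (by
        rw [smashIdx_zero_right, h0])
    simp only [h1]
    refine (HZpush_sum f x
      (fun t => ∑ j : Fin m, y j * φ (smashIdx n' m' t (g.toFun j.succ))) ?_).symm
    refine Finset.sum_eq_zero fun j _ => ?_
    rw [smashIdx_zero_left, h0, mul_zero]
  mul_assoc {n m k} x y z := by
    refine HZ_ext (n := n * (m * k)) fun φ h0 => ?_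
    refine (HZpush_sum (PMap.cast (Nat.mul_assoc n m k))
      (HZmul (n := n * m) (m := k) (HZmul (n := n) (m := m) x y) z) φ h0).trans ?_
    refine (HZmul_sum (HZmul (n := n) (m := m) x y) z
      (fun t => φ ((PMap.cast (Nat.mul_assoc n m k)).toFun t))).trans ?_
    refine (HZmul_sum (n := n) (m := m) x y (fun t => ∑ l : Fin k, z l *
      φ ((PMap.cast (Nat.mul_assoc n m k)).toFun (smashIdx (n * m) k t l.succ)))).trans ?_
    refine Eq.trans ?_ (HZmul_sum (n := n) (m := m * k) x (HZmul (n := m) (m := k) y z) φ).symm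
    refine Finset.sum_congr rfl fun i _ => ?_
    congr 1
    refine Eq.trans ?_ (HZmul_sum (n := m) (m := k) y z
      (fun t => φ (smashIdx n (m * k) i.succ t))).symm
    refine Finset.sum_congr rfl fun j _ => ?_
    congr 1
    refine Finset.sum_congr rfl fun l _ => ?_
    congr 2
    simp only [smashIdx_succ]
    apply Fin.ext
    simp only [PMap.cast, Fin.val_cast, Fin.val_succ, smashEquiv_val]
    ring
  one_mul {n} x := by
    refine HZ_ext (n := n) fun φ h0 => ?_
    refine (HZpush_sum (PMap.cast (Nat.one_mul n)) (HZmul (n := 1) (m := n) _ x) φ h0).trans ?_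
    refine (HZmul_sum (n := 1) (m := n) _ x
      (fun t => φ ((PMap.cast (Nat.one_mul n)).toFun t))).trans ?_
    rw [Fin.sum_univ_one]
    refine (congrArg (fun t : ℤ => t * _) (if_pos rfl)).trans ((_root_.one_mul _).trans ?_)
    refine Finset.sum_congr rfl fun j _ => ?_
    congr 2
    rw [smashIdx_succ]
    apply Fin.ext
    simp [PMap.cast, smashEquiv_val]
  mul_one {n} x := by
    refine HZ_ext (n := n) fun φ h0 => ?_
    refine (HZpush_sum (PMap.cast (Nat.mul_one n)) (HZmul (n := n) (m := 1) x _) φ h0).trans ?_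
    refine (HZmul_sum (n := n) (m := 1) x _
      (fun t => φ ((PMap.cast (Nat.mul_one n)).toFun t))).trans ?_
    refine Finset.sum_congr rfl fun j _ => ?_
    congr 1
    rw [Fin.sum_univ_one]
    refine (congrArg (fun t : ℤ => t * _) (if_pos rfl)).trans ((_root_.one_mul _).trans ?_)
    congr 1

/-- The element `(1, -1)` of `Hℤ[2]`. -/
def pmOne : HZ.El 2 := (![1, -1] : Fin 2 → ℤ)

/-- The element `(1, -1)^k` of `Hℤ[2^k]`, as a tuple. -/
def pmOnePow (k : ℕ) : Fin (2 ^ k) → ℤ := HZ.pow pmOne k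

/-- `A_+ ⊆ {1, ..., 2^k}`: the coordinates at which `(1, -1)^k` is `1`. -/
def Aplus (k : ℕ) : Set (Fin (2 ^ k)) := {i | pmOnePow k i = 1}

/-- `A_- ⊆ {1, ..., 2^k}`: the coordinates at which `(1, -1)^k` is `-1`. -/
def Aminus (k : ℕ) : Set (Fin (2 ^ k)) := {i | pmOnePow k i = -1}

/-! ### Formal difference laws -/

/-- `r ∈ R[2]` is a formal difference law in the discrete `Γ`-ring `R`. (Recall that the element `i`
of `{1, ..., n}` has the index `i - 1` in `Fin n`.) -/
structure IsFormalDifferenceLaw (R : DiscreteGammaRing.{u}) (r : R.El 2) : Prop where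
  /-- `p^2_2(r) = 1` -/
  p_two : R.act (PMap.p 2 1) r = R.one
  /-- `s^2_{1,2,1}(r) = 0` -/
  s_one_two : R.act (PMap.s 2 0 1 (by decide) 0) r = R.pt 1
  /-- `p^2_1(r) r = σ(r)` -/
  neg_mul : R.lmul (R.act (PMap.p 2 0) r) r = R.act (PMap.perm (Equiv.swap 0 1)) r
  /-- `r p^2_1(r) = σ(r)` -/
  mul_neg : R.rmul r (R.act (PMap.p 2 0) r) = R.act (PMap.perm (Equiv.swap 0 1)) r
  /-- `r^k` is fixed by the permutations of `{1, ..., 2^k}` which preserve `A_+` and `A_-`. -/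
  perm_pow : ∀ (k : ℕ) (π : Equiv.Perm (Fin (2 ^ k))),
    (∀ i, i ∈ Aplus k → π i ∈ Aplus k) → (∀ i, i ∈ Aminus k → π i ∈ Aminus k) →
    R.act (PMap.perm π) (R.pow r k) = R.pow r k
  /-- `s_{i,j,l}(r^k) = d_l p_i p_j (r^k)` for `i < j` of different signs. -/
  s_pow : ∀ (k : ℕ) (i j : Fin (2 ^ k)) (hij : i < j) (l : Fin (2 ^ k - 1)),
    (i ∈ Aplus k ∧ j ∈ Aminus k) ∨ (j ∈ Aplus k ∧ i ∈ Aminus k) →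
    R.act (PMap.s (2 ^ k) i j hij l) (R.pow r k) =
      R.act (PMap.d (2 ^ k - 1) l)
        (R.act (PMap.p (2 ^ k - 1)
            ⟨i.1, lt_of_lt_of_le hij (Nat.le_sub_one_of_lt j.2)⟩)
          (R.act (PMap.p (2 ^ k) j) (R.pow r k)))

/-- The set of formal difference laws in `R`. -/
def FDL (R : DiscreteGammaRing.{u}) : Type u := {r : R.El 2 // IsFormalDifferenceLaw R r}

namespace DiscreteGammaRing

theorem Hom.app_pow {R : DiscreteGammaRing.{u}} {R' : DiscreteGammaRing.{v}} (f : Hom R R')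
    {n : ℕ} (x : R.El n) (k : ℕ) : f.app (n ^ k) (R.pow x k) = R'.pow (f.app n x) k := by
  induction k with
  | zero => exact f.app_unit 1 1
  | succ k ih => exact (f.app_mul (R.pow x k) x).trans (by rw [ih]; rfl)

theorem Hom.app_lmul {R : DiscreteGammaRing.{u}} {R' : DiscreteGammaRing.{v}} (f : Hom R R')
    {n : ℕ} (a : R.El 1) (x : R.El n) :
    f.app n (R.lmul a x) = R'.lmul (f.app 1 a) (f.app n x) := by
  rw [lmul, f.app_act, f.app_mul, lmul]

theorem Hom.app_rmul {R : DiscreteGammaRing.{u}} {R' : DiscreteGammaRing.{v}} (f : Hom R R')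
    {n : ℕ} (a : R.El 1) (x : R.El n) :
    f.app n (R.rmul x a) = R'.rmul (f.app n x) (f.app 1 a) := by
  rw [rmul, f.app_act, f.app_mul, rmul]

/-- Multiplicative maps send formal difference laws to formal difference laws. -/
def Hom.mapFDL {R : DiscreteGammaRing.{u}} {R' : DiscreteGammaRing.{v}} (f : Hom R R')
    (r : FDL R) : FDL R' :=
  ⟨f.app 2 r.1, {
    p_two := by
      rw [← f.app_act (PMap.p 2 1), r.2.p_two]; exact f.app_unit 1 1
    s_one_two := by
      rw [← f.app_act (PMap.s 2 0 1 _ 0), r.2.s_one_two]; exact f.app_pt 1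
    neg_mul := by
      rw [← f.app_act (PMap.p 2 0), ← f.app_act (PMap.perm _), ← r.2.neg_mul]
      exact (f.app_lmul _ _).symm
    mul_neg := by
      rw [← f.app_act (PMap.p 2 0), ← f.app_act (PMap.perm _), ← r.2.mul_neg]
      exact (f.app_rmul _ _).symm
    perm_pow := fun k π h1 h2 => by
      rw [← f.app_pow, ← f.app_act, r.2.perm_pow k π h1 h2]
    s_pow := fun k i j hij l h => by
      rw [← f.app_pow, ← f.app_act, r.2.s_pow k i j hij l h, f.app_act, f.app_act, f.app_act] }⟩

end DiscreteGammaRing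

/-! ### Invertible elements of `R[1]` and conjugation -/

theorem PMap.smash_cast {n n' m m' : ℕ} (h : n = n') (h' : m = m') :
    (PMap.cast h).smash (PMap.cast h') = PMap.cast (by rw [h, h']) := by
  subst h h'
  ext a : 2
  induction a using Fin.cases with
  | zero => rfl
  | succ c =>
    change smashIdx n m ((smashEquiv n m).symm c).1.succ ((smashEquiv n m).symm c).2.succ = c.succ
    rw [smashIdx_succ, Prod.mk.eta, Equiv.apply_symm_apply]

theorem PMap.cast_smash_one {n m : ℕ} (f : PMap n m) :
    (PMap.cast (Nat.mul_one m)).comp (f.smash (PMap.id 1)) =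
      f.comp (PMap.cast (Nat.mul_one n)) := by
  ext a : 2
  induction a using Fin.cases with
  | zero => exact (PMap.map_zero _).trans (PMap.map_zero _).symm
  | succ c =>
    obtain ⟨⟨x, y⟩, rfl⟩ := (smashEquiv n 1).surjective c
    have hy : y = 0 := Subsingleton.elim _ _
    subst hy
    change (PMap.cast (Nat.mul_one m)).toFun ((f.smash (PMap.id 1)).toFun _) =
      f.toFun ((PMap.cast (Nat.mul_one n)).toFun _)
    rw [← smashIdx_succ, PMap.smash_smashIdx]
    have h : ∀ (l : ℕ) (t : Fin (l + 1)),
        (PMap.cast (Nat.mul_one l)).toFun (smashIdx l 1 t (Fin.succ 0)) = t := by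
      intro l t
      induction t using Fin.cases with
      | zero => rfl
      | succ t =>
        rw [smashIdx_succ]; apply Fin.ext; simp [PMap.cast, smashEquiv_val]
    rw [h]
    exact h m _

theorem PMap.cast_one_smash {n m : ℕ} (f : PMap n m) :
    (PMap.cast (Nat.one_mul m)).comp ((PMap.id 1).smash f) =
      f.comp (PMap.cast (Nat.one_mul n)) := by
  ext a : 2
  induction a using Fin.cases with
  | zero => exact (PMap.map_zero _).trans (PMap.map_zero _).symm
  | succ c =>
    obtain ⟨⟨y, x⟩, rfl⟩ := (smashEquiv 1 n).surjective c
    have hy : y = 0 := Subsingleton.elim _ _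
    subst hy
    change (PMap.cast (Nat.one_mul m)).toFun (((PMap.id 1).smash f).toFun _) =
      f.toFun ((PMap.cast (Nat.one_mul n)).toFun _)
    rw [← smashIdx_succ, PMap.smash_smashIdx]
    have h : ∀ (l : ℕ) (t : Fin (l + 1)),
        (PMap.cast (Nat.one_mul l)).toFun (smashIdx 1 l (Fin.succ 0) t) = t := by
      intro l t
      induction t using Fin.cases with
      | zero => rfl
      | succ t =>
        rw [smashIdx_succ]; apply Fin.ext; simp [PMap.cast, smashEquiv_val]
    rw [h]
    exact h m _

namespace DiscreteGammaRing

variable (R : DiscreteGammaRing.{u})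

theorem act_cast_cast {n m k : ℕ} (h : n = m) (h' : m = k) (x : R.El n) :
    R.act (PMap.cast h') (R.act (PMap.cast h) x) = R.act (PMap.cast (h.trans h')) x := by
  rw [← R.act_comp]; rfl

theorem mul_cast {n n' m m' : ℕ} (h : n = n') (h' : m = m') (x : R.El n) (y : R.El m) :
    R.mul (R.act (PMap.cast h) x) (R.act (PMap.cast h') y) =
      R.act (PMap.cast (by rw [h, h'])) (R.mul x y) := by
  rw [← R.mul_nat, PMap.smash_cast]

theorem act_cast_rfl {n : ℕ} (h : n = n) (x : R.El n) : R.act (PMap.cast h) x = x := R.act_id x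

theorem mul_cast_left {n n' m : ℕ} (h : n = n') (x : R.El n) (y : R.El m) :
    R.mul (R.act (PMap.cast h) x) y = R.act (PMap.cast (by rw [h])) (R.mul x y) := by
  have := R.mul_cast h (rfl : m = m) x y
  rwa [act_cast_rfl] at this

theorem mul_cast_right {n m m' : ℕ} (h : m = m') (x : R.El n) (y : R.El m) :
    R.mul x (R.act (PMap.cast h) y) = R.act (PMap.cast (by rw [h])) (R.mul x y) := by
  have := R.mul_cast (rfl : n = n) h x y
  rwa [act_cast_rfl] at this

theorem lmul_mul {n m : ℕ} (a : R.El 1) (x : R.El n) (y : R.El m) :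
    R.mul (R.lmul a x) y = R.lmul a (R.mul x y) := by
  rw [lmul, lmul, mul_cast_left, ← R.mul_assoc, act_cast_cast]

theorem mul_rmul {n m : ℕ} (x : R.El n) (y : R.El m) (a : R.El 1) :
    R.mul x (R.rmul y a) = R.rmul (R.mul x y) a := by
  rw [rmul, rmul, mul_cast_right, ← R.mul_assoc, act_cast_cast]

theorem rmul_mul {n m : ℕ} (x : R.El n) (a : R.El 1) (y : R.El m) :
    R.mul (R.rmul x a) y = R.mul x (R.lmul a y) := by
  rw [rmul, lmul, mul_cast_left, mul_cast_right, ← R.mul_assoc, act_cast_cast]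

theorem lmul_lmul {n : ℕ} (a b : R.El 1) (x : R.El n) :
    R.lmul (R.lmul a b) x = R.lmul a (R.lmul b x) := by
  rw [lmul, lmul_mul, lmul, lmul, lmul, mul_cast_right]

theorem rmul_rmul {n : ℕ} (x : R.El n) (a b : R.El 1) :
    R.rmul (R.rmul x a) b = R.rmul x (R.rmul a b) := by
  have h : R.rmul a b = R.lmul a b := rfl
  rw [h, rmul, rmul_mul, rmul]

theorem lmul_rmul {n : ℕ} (a : R.El 1) (x : R.El n) (b : R.El 1) :
    R.rmul (R.lmul a x) b = R.lmul a (R.rmul x b) := by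
  rw [rmul, lmul_mul, rmul, lmul, lmul, mul_cast_right, act_cast_cast, act_cast_cast]

theorem act_lmul {n m : ℕ} (f : PMap n m) (a : R.El 1) (x : R.El n) :
    R.act f (R.lmul a x) = R.lmul a (R.act f x) := by
  have h := R.mul_nat (PMap.id 1) f a x
  rw [R.act_id] at h
  rw [lmul, lmul, ← h, ← R.act_comp, ← R.act_comp, PMap.cast_one_smash]

theorem act_rmul {n m : ℕ} (f : PMap n m) (x : R.El n) (a : R.El 1) :
    R.act f (R.rmul x a) = R.rmul (R.act f x) a := by
  have h := R.mul_nat f (PMap.id 1) x a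
  rw [R.act_id] at h
  rw [rmul, rmul, ← h, ← R.act_comp, ← R.act_comp, PMap.cast_smash_one]

/-- The monoid `R[1]`, with product `R[1] ∧ R[1] → R([1] ∧ [1]) = R[1]`. -/
instance monoidOne : Monoid (R.El 1) where
  mul a b := R.lmul a b
  one := R.one
  mul_assoc a b c := R.lmul_lmul a b c
  one_mul a := R.one_mul a
  mul_one a := R.mul_one a

theorem one_lmul {n : ℕ} (x : R.El n) : R.lmul 1 x = x := R.one_mul x

theorem rmul_one {n : ℕ} (x : R.El n) : R.rmul x 1 = x := R.mul_one x

theorem rmul_mul_lmul {n m : ℕ} (a b : R.El 1) (h : a * b = 1) (x : R.El n) (y : R.El m) :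
    R.mul (R.rmul x a) (R.lmul b y) = R.mul x y := by
  rw [rmul_mul, ← lmul_lmul]
  change R.mul x (R.lmul (a * b) y) = _
  rw [h, one_lmul]

/-- Conjugation `x ↦ g x g⁻¹` by an invertible element `g` of `R[1]`, as a multiplicative map
`R → R`. -/
def conj (g : (R.El 1)ˣ) : Hom R R where
  app n x := R.rmul (R.lmul g.1 x) g⁻¹.1
  app_pt n := by
    rw [lmul, R.mul_pt, R.act_pt, rmul, R.pt_mul, R.act_pt]
  app_act f x := by rw [act_rmul, act_lmul]
  app_unit n a := by
    have h : ∀ a : Fin (n + 1), ∃ f : PMap 1 n, f.toFun 1 = a := fun a =>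
      ⟨⟨Fin.cases 0 (fun _ => a), rfl⟩, rfl⟩
    obtain ⟨f, rfl⟩ := h a
    rw [← R.unit_nat f 1, ← act_lmul, ← act_rmul]
    congr 1
    exact (congrArg (fun t => t * g⁻¹.1) (R.mul_one g.1)).trans g.mul_inv
  app_mul x y := by
    rw [lmul_rmul R g.1 y, rmul_mul_lmul R _ _ g.inv_mul, lmul_mul, mul_rmul, lmul_rmul]

theorem conj_one : R.conj 1 = Hom.id R := by
  ext n x
  change R.rmul (R.lmul (1 : (R.El 1)ˣ).1 x) (1 : (R.El 1)ˣ)⁻¹.1 = x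
  rw [inv_one, Units.val_one, one_lmul, rmul_one]

theorem conj_mul (g h : (R.El 1)ˣ) : R.conj (g * h) = (R.conj g).comp (R.conj h) := by
  ext n x
  change R.rmul (R.lmul (g * h).1 x) (g * h)⁻¹.1 =
    R.rmul (R.lmul g.1 (R.rmul (R.lmul h.1 x) h⁻¹.1)) g⁻¹.1
  rw [mul_inv_rev, Units.val_mul, Units.val_mul]
  change R.rmul (R.lmul (R.lmul g.1 h.1) x) (R.rmul h⁻¹.1 g⁻¹.1) = _
  rw [← rmul_rmul, lmul_lmul, lmul_rmul]

/-- The monoid homomorphism `R[1] → R'[1]` induced by a multiplicative map. -/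
def Hom.monoidHom {R : DiscreteGammaRing.{u}} {R' : DiscreteGammaRing.{v}} (f : Hom R R') :
    R.El 1 →* R'.El 1 where
  toFun := f.app 1
  map_one' := f.app_unit 1 1
  map_mul' a b := f.app_lmul a b

theorem Hom.comp_conj {R : DiscreteGammaRing.{u}} {R' : DiscreteGammaRing.{v}} (f : Hom R R')
    (g : (R.El 1)ˣ) : f.comp (R.conj g) = (R'.conj (Units.map f.monoidHom g)).comp f := by
  ext n x
  exact (f.app_rmul _ _).trans (congrArg (fun t => R'.rmul t _) (f.app_lmul _ _))

end DiscreteGammaRing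

/-! ### `Γ`-rings -/

/-- A `Γ`-space: a functor `F` from `Γ^op` to pointed simplicial sets with `F[0]` a point. -/
structure GammaSpace where
  functor : GammaOp ⥤ SimplicialObject Pointed.{u}
  zero : ∀ d : SimplexCategoryᵒᵖ, Subsingleton ((functor.obj ⟨0⟩).obj d)

/-- The discrete `Γ`-space `[n] ↦ F[n]_d` of `d`-simplices. -/
def GammaSpace.level (F : GammaSpace.{u}) (d : SimplexCategoryᵒᵖ) : DiscreteGammaSpace.{u} where
  functor := F.functor ⋙ (evaluation _ _).obj d
  zero := F.zero d

/-- The simplicial structure map `F[n]_d → F[n]_e` induced by `θ`. -/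
def GammaSpace.simp (F : GammaSpace.{u}) {d e : SimplexCategoryᵒᵖ} (θ : d ⟶ e) {n : ℕ}
    (x : (F.level d).El n) : (F.level e).El n :=
  ((F.functor.obj ⟨n⟩).map θ).toFun x

/-- A `Γ`-ring: a `Γ`-space `F` with a unit `η : 𝐒 → F`, where `𝐒[n] = [n]` (as a constant
simplicial set), and a multiplication `F ∧ F → F`, given by maps of pointed simplicial sets
`F[n] ∧ F[m] → F([n] ∧ [m]) = F[nm]` natural in `[n]` and `[m]`, which is associative and
unital. -/
structure GammaRing extends GammaSpace.{u} where
  unit : ∀ (d : SimplexCategoryᵒᵖ) (n : ℕ), Fin (n + 1) → (toGammaSpace.level d).El n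
  unit_zero : ∀ (d : SimplexCategoryᵒᵖ) (n : ℕ), unit d n 0 = (toGammaSpace.level d).pt n
  unit_nat : ∀ (d : SimplexCategoryᵒᵖ) {n m : ℕ} (f : PMap n m) (a : Fin (n + 1)),
    (toGammaSpace.level d).act f (unit d n a) = unit d m (f.toFun a)
  simp_unit : ∀ {d e : SimplexCategoryᵒᵖ} (θ : d ⟶ e) (n : ℕ) (a : Fin (n + 1)),
    toGammaSpace.simp θ (unit d n a) = unit e n a
  mul : ∀ (d : SimplexCategoryᵒᵖ) {n m : ℕ}, (toGammaSpace.level d).El n →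
    (toGammaSpace.level d).El m → (toGammaSpace.level d).El (n * m)
  pt_mul : ∀ (d : SimplexCategoryᵒᵖ) {n m : ℕ} (y : (toGammaSpace.level d).El m),
    mul d ((toGammaSpace.level d).pt n) y = (toGammaSpace.level d).pt (n * m)
  mul_pt : ∀ (d : SimplexCategoryᵒᵖ) {n m : ℕ} (x : (toGammaSpace.level d).El n),
    mul d x ((toGammaSpace.level d).pt m) = (toGammaSpace.level d).pt (n * m)
  mul_nat : ∀ (d : SimplexCategoryᵒᵖ) {n m n' m' : ℕ} (f : PMap n n') (g : PMap m m')
    (x : (toGammaSpace.level d).El n) (y : (toGammaSpace.level d).El m),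
    (toGammaSpace.level d).act (f.smash g) (mul d x y) =
      mul d ((toGammaSpace.level d).act f x) ((toGammaSpace.level d).act g y)
  simp_mul : ∀ {d e : SimplexCategoryᵒᵖ} (θ : d ⟶ e) {n m : ℕ}
    (x : (toGammaSpace.level d).El n) (y : (toGammaSpace.level d).El m),
    toGammaSpace.simp θ (mul d x y) = mul e (toGammaSpace.simp θ x) (toGammaSpace.simp θ y)
  mul_assoc : ∀ (d : SimplexCategoryᵒᵖ) {n m k : ℕ} (x : (toGammaSpace.level d).El n)
    (y : (toGammaSpace.level d).El m) (z : (toGammaSpace.level d).El k),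
    (toGammaSpace.level d).act (PMap.cast (Nat.mul_assoc n m k)) (mul d (mul d x y) z) =
      mul d x (mul d y z)
  one_mul : ∀ (d : SimplexCategoryᵒᵖ) {n : ℕ} (x : (toGammaSpace.level d).El n),
    (toGammaSpace.level d).act (PMap.cast (Nat.one_mul n)) (mul d (unit d 1 1) x) = x
  mul_one : ∀ (d : SimplexCategoryᵒᵖ) {n : ℕ} (x : (toGammaSpace.level d).El n),
    (toGammaSpace.level d).act (PMap.cast (Nat.mul_one n)) (mul d x (unit d 1 1)) = x

/-! ### Homotopy orbits -/

/-- A (left) action of the simplicial group `G` on the simplicial set `X`. -/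
structure SimplicialAction (G : SimplicialObject GrpCat.{u}) (X : SSet.{u}) where
  smul : ∀ {d : SimplexCategoryᵒᵖ}, G.obj d → X.obj d → X.obj d
  one_smul : ∀ {d : SimplexCategoryᵒᵖ} (x : X.obj d), smul 1 x = x
  mul_smul : ∀ {d : SimplexCategoryᵒᵖ} (g h : G.obj d) (x : X.obj d),
    smul (g * h) x = smul g (smul h x)
  map_smul : ∀ {d e : SimplexCategoryᵒᵖ} (θ : d ⟶ e) (g : G.obj d) (x : X.obj d),
    X.map θ (smul g x) = smul (G.map θ g) (X.map θ x)

namespace SimplicialAction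

variable {G : SimplicialObject GrpCat.{u}} {X : SSet.{u}}

/-- Two `d`-simplices are equivalent if they lie in the same orbit. -/
def orbitSetoid (A : SimplicialAction G X) (d : SimplexCategoryᵒᵖ) : Setoid (X.obj d) where
  r x y := ∃ g : G.obj d, A.smul g x = y
  iseqv :=
    { refl := fun x => ⟨1, A.one_smul x⟩
      symm := by
        rintro x y ⟨g, rfl⟩
        exact ⟨g⁻¹, by rw [← A.mul_smul, inv_mul_cancel, A.one_smul]⟩
      trans := by
        rintro x y z ⟨g, rfl⟩ ⟨h, rfl⟩
        exact ⟨h * g, A.mul_smul h g x⟩ }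

/-- The simplicial set of orbits `X / G`. -/
def orbits (A : SimplicialAction G X) : SSet.{u} where
  obj d := Quotient (A.orbitSetoid d)
  map {d e} θ := ↾(Quotient.map (sa := A.orbitSetoid d) (sb := A.orbitSetoid e) (X.map θ) (by
    rintro x y ⟨g, rfl⟩
    exact ⟨G.map θ g, (A.map_smul θ g x).symm⟩))
  map_id d := by
    ext x
    induction x using Quotient.inductionOn with | _ x => ?_
    change Quotient.mk (A.orbitSetoid d) (X.map (𝟙 d) x) = Quotient.mk (A.orbitSetoid d) x
    rw [X.map_id]; rfl
  map_comp {d e f} θ ψ := by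
    ext x
    induction x using Quotient.inductionOn with | _ x => ?_
    change Quotient.mk (A.orbitSetoid f) (X.map (θ ≫ ψ) x) =
      Quotient.mk (A.orbitSetoid f) (X.map ψ (X.map θ x))
    rw [X.map_comp]; rfl

end SimplicialAction

/-- The product `E G × X`, where `E G` is the contractible simplicial set whose `d`-simplices are the
tuples `(h_0, ..., h_d)` of elements of `G_d`; a map `θ` of the simplex category acts by
`(h_i)_i ↦ (θ^* h_{θ(i)})_i`. -/
def EGProd (G : SimplicialObject GrpCat.{u}) (X : SSet.{u}) : SSet.{u} where
  obj d := (Fin (d.unop.len + 1) → G.obj d) × X.obj d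
  map {d e} θ := ↾(fun z => (fun i => G.map θ (z.1 (θ.unop.toOrderHom i)), X.map θ z.2))
  map_id d := by
    ext z
    · simp
    · simp
  map_comp θ ψ := by
    ext z
    · simp
    · simp

/-- The diagonal action of `G` on `E G × X`, given on `E G` by left multiplication. -/
def SimplicialAction.diagonal {G : SimplicialObject GrpCat.{u}} {X : SSet.{u}}
    (A : SimplicialAction G X) : SimplicialAction G (EGProd G X) where
  smul g z := (fun i => g * z.1 i, A.smul g z.2)
  one_smul z := by
    change ((fun i => 1 * z.1 i, A.smul 1 z.2) : _ × _) = z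
    simp only [_root_.one_mul, A.one_smul]
    rfl
  mul_smul g h z := by
    simp only [_root_.mul_assoc, A.mul_smul]
    rfl
  map_smul θ g z := by
    change ((fun i => G.map θ (g * z.1 _), X.map θ (A.smul g z.2)) : _ × _) =
      (fun i => G.map θ g * G.map θ (z.1 _), A.smul (G.map θ g) (X.map θ z.2))
    simp only [_root_.map_mul, A.map_smul]

/-- The homotopy orbits `X_{hG} = E G ×_G X`. -/
def SimplicialAction.homotopyOrbits {G : SimplicialObject GrpCat.{u}} {X : SSet.{u}}
    (A : SimplicialAction G X) : SSet.{u} :=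
  A.diagonal.orbits

/-- The simplex of `X_{hG}` represented by `(h, x)`. -/
def SimplicialAction.homotopyOrbitMk {G : SimplicialObject GrpCat.{u}} {X : SSet.{u}}
    (A : SimplicialAction G X) {d : SimplexCategoryᵒᵖ} (h : Fin (d.unop.len + 1) → G.obj d)
    (x : X.obj d) : A.homotopyOrbits.obj d :=
  Quotient.mk (A.diagonal.orbitSetoid d) (h, x)

/-! ### The simplicial sets attached to a `Γ`-ring -/

namespace GammaRing

variable (R : GammaRing.{u})

/-- The discrete `Γ`-ring `R_d`: the simplicial degree `d` of `R`. -/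
def ringLevel (d : SimplexCategoryᵒᵖ) : DiscreteGammaRing.{u} where
  toDiscreteGammaSpace := R.toGammaSpace.level d
  unit := R.unit d
  unit_zero := R.unit_zero d
  unit_nat := R.unit_nat d
  mul := R.mul d
  pt_mul := R.pt_mul d
  mul_pt := R.mul_pt d
  mul_nat := R.mul_nat d
  mul_assoc := R.mul_assoc d
  one_mul := R.one_mul d
  mul_one := R.mul_one d

/-- The simplicial structure map `R_d → R_e`. -/
def levelMap {d e : SimplexCategoryᵒᵖ} (θ : d ⟶ e) :
    DiscreteGammaRing.Hom (R.ringLevel d) (R.ringLevel e) where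
  app _ x := R.simp θ x
  app_pt n := ((R.functor.obj ⟨n⟩).map θ).map_point
  app_act {n m} f x := by
    have h := (R.functor.map (X := ⟨n⟩) (Y := ⟨m⟩) f).naturality θ
    exact (congrFun (congrArg Pointed.Hom.toFun h) x).symm
  app_unit n a := R.simp_unit θ n a
  app_mul x y := R.simp_mul θ x y

theorem levelMap_id (d : SimplexCategoryᵒᵖ) :
    R.levelMap (𝟙 d) = DiscreteGammaRing.Hom.id (R.ringLevel d) := by
  ext n x
  exact congrFun (congrArg Pointed.Hom.toFun ((R.functor.obj ⟨n⟩).map_id d)) x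

theorem levelMap_comp {d e f : SimplexCategoryᵒᵖ} (θ : d ⟶ e) (ψ : e ⟶ f) :
    R.levelMap (θ ≫ ψ) = (R.levelMap ψ).comp (R.levelMap θ) := by
  ext n x
  exact congrFun (congrArg Pointed.Hom.toFun ((R.functor.obj ⟨n⟩).map_comp θ ψ)) x

/-- The simplicial group `G_*` of invertible elements of `R_*[1]`. -/
def unitGroup : SimplicialObject GrpCat.{u} where
  obj d := GrpCat.of ((R.ringLevel d).El 1)ˣ
  map θ := GrpCat.ofHom (Units.map (R.levelMap θ).monoidHom)
  map_id d := by
    ext g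
    exact congrArg (fun f => DiscreteGammaRing.Hom.app f 1 g.1) (R.levelMap_id d)
  map_comp θ ψ := by
    ext g
    exact congrArg (fun f => DiscreteGammaRing.Hom.app f 1 g.1) (R.levelMap_comp θ ψ)

/-- The simplicial set `FDL(R)_*` of formal difference laws in the rings `R_*`. -/
def fdl : SSet.{u} where
  obj d := FDL (R.ringLevel d)
  map θ := ↾((R.levelMap θ).mapFDL)
  map_id d := by
    ext r
    apply Subtype.ext
    exact congrArg (fun f => DiscreteGammaRing.Hom.app f 2 r.1) (R.levelMap_id d)
  map_comp θ ψ := by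
    ext r
    apply Subtype.ext
    exact congrArg (fun f => DiscreteGammaRing.Hom.app f 2 r.1) (R.levelMap_comp θ ψ)

/-- The simplicial set `Γ(Hℤ, R)_*` of multiplicative maps from `Hℤ` to the rings `R_*`. -/
def multMaps : SSet.{u} where
  obj d := DiscreteGammaRing.Hom HZ (R.ringLevel d)
  map θ := ↾(fun φ => (R.levelMap θ).comp φ)
  map_id d := by
    refine TypeCat.homEquiv.injective (funext fun φ => ?_)
    exact congrArg (fun f => DiscreteGammaRing.Hom.comp f φ) (R.levelMap_id d)
  map_comp θ ψ := by
    refine TypeCat.homEquiv.injective (funext fun φ => ?_)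
    exact congrArg (fun f => DiscreteGammaRing.Hom.comp f φ) (R.levelMap_comp θ ψ)

/-- The conjugation action `r ↦ g r g⁻¹` of `G_*` on `FDL(R)_*`. -/
def fdlConj : SimplicialAction R.unitGroup R.fdl where
  smul {d} g r := ((R.ringLevel d).conj g).mapFDL r
  one_smul {d} r := by
    apply Subtype.ext
    exact congrArg (fun f => DiscreteGammaRing.Hom.app f 2 r.1) (R.ringLevel d).conj_one
  mul_smul {d} g h r := by
    apply Subtype.ext
    exact congrArg (fun f => DiscreteGammaRing.Hom.app f 2 r.1) ((R.ringLevel d).conj_mul g h)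
  map_smul θ g r := by
    apply Subtype.ext
    exact congrArg (fun f => DiscreteGammaRing.Hom.app f 2 r.1) ((R.levelMap θ).comp_conj g)

/-- The conjugation action `(g φ)(x) = g φ(x) g⁻¹` of `G_*` on `Γ(Hℤ, R)_*`. -/
def multMapsConj : SimplicialAction R.unitGroup R.multMaps where
  smul {d} g φ := ((R.ringLevel d).conj g).comp φ
  one_smul {d} φ :=
    congrArg (fun f => DiscreteGammaRing.Hom.comp f φ) (R.ringLevel d).conj_one
  mul_smul {d} g h φ :=
    congrArg (fun f => DiscreteGammaRing.Hom.comp f φ) ((R.ringLevel d).conj_mul g h)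
  map_smul θ g φ :=
    congrArg (fun f => DiscreteGammaRing.Hom.comp f φ) ((R.levelMap θ).comp_conj g)

end GammaRing

/-! ### Coordinates of `(1, -1)^k` -/

/-! The ring `HZ` is generated by `(1, -1)`: every tuple has the form `f_*((1, -1)^k)` for a pointed
map `f` out of `[2^k]` (`exists_HZpush_eq`). A multiplicative map `φ` out of `HZ` is therefore
determined by `r = φ(1, -1)`, and `r` is a formal difference law because `(1, -1)` is one and
multiplicative maps preserve the defining equations.

Conversely, a law `r` should give the map `f_*((1, -1)^k) ↦ f_*(r^k)`, and the content of the
theorem is that this is well defined (`IsFormalDifferenceLaw.act_pow_eq_act_pow`). Since `p^2_2(r) =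
1`, a power of `r` is recovered from any higher one, so the exponents may be taken equal. By
condition 4, two coordinates of opposite sign in the same fibre of `f` may be moved to the base
point without changing `f_*(r^k)`; after finitely many such steps `f` is reduced, that is, each
fibre away from the base point carries a single sign. The tuple `f_*((1, -1)^k)` then determines how
many coordinates of each sign lie in each fibre, so two reduced maps with the same tuple differ by a
permutation preserving `A_+` and `A_-`, which fixes `r^k` by condition 3. Multiplicativity follows
from `r^k r^l = r^(k+l)` and naturality.

The resulting bijection is evaluation at `(1, -1)`. It commutes with postcomposition by
multiplicative maps, hence with the simplicial structure and with conjugation, and so passes to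
homotopy orbits. -/

theorem pmOnePow_eq_one_or (k : ℕ) (i : Fin (2 ^ k)) :
    pmOnePow k i = 1 ∨ pmOnePow k i = -1 := by
  induction k with
  | zero =>
    left
    have : i = 0 := Subsingleton.elim (α := Fin 1) _ _
    subst this
    rfl
  | succ k ih =>
    change HZmul (n := 2 ^ k) (m := 2) (pmOnePow k) ![1, -1] i = 1 ∨
      HZmul (n := 2 ^ k) (m := 2) (pmOnePow k) ![1, -1] i = -1
    unfold HZmul
    generalize (smashEquiv (2 ^ k) 2).symm i = x
    obtain ⟨a, b⟩ := x
    rcases ih a with h | h <;> fin_cases b <;> simp [h]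

theorem mem_Aplus {k : ℕ} {i : Fin (2 ^ k)} : i ∈ Aplus k ↔ pmOnePow k i = 1 := Iff.rfl

theorem mem_Aminus {k : ℕ} {i : Fin (2 ^ k)} : i ∈ Aminus k ↔ pmOnePow k i = -1 := Iff.rfl

/-! ### Combinatorics of the pointed maps occurring in condition 4 -/

namespace PMap

theorem perm_succ {n : ℕ} (π : Equiv.Perm (Fin n)) (a : Fin n) :
    (perm π).toFun a.succ = (π a).succ := rfl

theorem comp_apply {n m k : ℕ} (g : PMap m k) (f : PMap n m) (a : Fin (n + 1)) :
    (g.comp f).toFun a = g.toFun (f.toFun a) := rfl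

theorem comp_assoc {n m k l : ℕ} (h : PMap k l) (g : PMap m k) (f : PMap n m) :
    (h.comp g).comp f = h.comp (g.comp f) := rfl

/-- The composite `d_l p_i p_j` sends `i` and `j` to the base point and is `s_{i,j,l}` elsewhere. -/
theorem d_p_p_apply (n : ℕ) (i j : Fin n) (hij : i < j) (l : Fin (n - 1)) (a : Fin (n + 1)) :
    ((d (n - 1) l).comp ((p (n - 1) ⟨i.1, lt_of_lt_of_le hij (Nat.le_sub_one_of_lt j.2)⟩).comp
      (p n j))).toFun a = if a = i.succ ∨ a = j.succ then 0 else (s n i j hij l).toFun a := by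
  have hij' : i.1 < j.1 := hij
  have := a.2
  simp only [Fin.ext_iff, Fin.val_succ, comp_apply]
  split_ifs with h
  · rcases h with h | h <;> simp only [d, p, h, Fin.val_zero] <;> split_ifs <;> omega
  · simp only [d, p, s, h, if_false]
    split_ifs <;> omega

theorem s_apply_left (n : ℕ) (i j : Fin n) (hij : i < j) (l : Fin (n - 1)) :
    (s n i j hij l).toFun i.succ = ⟨l.1 + 1, Nat.succ_lt_succ l.2⟩ := by
  apply Fin.ext
  simp [s]

theorem s_apply_right (n : ℕ) (i j : Fin n) (hij : i < j) (l : Fin (n - 1)) :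
    (s n i j hij l).toFun j.succ = ⟨l.1 + 1, Nat.succ_lt_succ l.2⟩ := by
  apply Fin.ext
  simp [s]

/-- The only distinct elements which `s_{i,j,l}` identifies are `i` and `j`. -/
theorem s_apply_eq_iff (n : ℕ) (i j : Fin n) (hij : i < j) (l : Fin (n - 1)) (a b : Fin (n + 1))
    (h : (s n i j hij l).toFun a = (s n i j hij l).toFun b) :
    a = b ∨ (a = i.succ ∨ a = j.succ) ∧ (b = i.succ ∨ b = j.succ) := by
  have hij' : i.1 < j.1 := hij
  simp only [Fin.ext_iff, Fin.val_succ, s] at h ⊢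
  by_cases ha : a.1 = i.1 + 1 ∨ a.1 = j.1 + 1 <;> by_cases hb : b.1 = i.1 + 1 ∨ b.1 = j.1 + 1
  · exact Or.inr ⟨ha, hb⟩
  · simp only [ha, hb, if_true, if_false] at h
    split_ifs at h <;> omega
  · simp only [ha, hb, if_true, if_false] at h
    split_ifs at h <;> omega
  · simp only [ha, hb, if_false] at h
    split_ifs at h <;> omega

/-- The pointed map which sends `i` and `j` to the base point and agrees with `f` elsewhere. -/
def erase {n m : ℕ} (f : PMap n m) (i j : Fin n) : PMap n m :=
  ⟨fun a => if a = i.succ ∨ a = j.succ then 0 else f.toFun a, by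
    rw [if_neg, f.map_zero]
    simp [(Fin.succ_ne_zero _).symm]⟩

/-- A pointed map which agrees on `i` and `j` factors through `s_{i,j,l}`. -/
theorem exists_comp_s_eq {n m : ℕ} (f : PMap n m) (i j : Fin n) (hij : i < j) (l : Fin (n - 1))
    (hf : f.toFun i.succ = f.toFun j.succ) : ∃ g : PMap (n - 1) m, g.comp (s n i j hij l) = f := by
  have hfac : f.toFun.FactorsThrough (s n i j hij l).toFun := by
    intro a b hab
    rcases s_apply_eq_iff n i j hij l a b hab with rfl | ⟨rfl | rfl, rfl | rfl⟩ <;> simp [hf]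
  have key := hfac.extend_apply (fun _ => 0)
  -- As `s_{i,j,l}` is surjective, the default value `0` of the extension is never taken.
  refine ⟨⟨Function.extend (s n i j hij l).toFun f.toFun fun _ => 0, ?_⟩, PMap.ext (funext key)⟩
  have := key 0
  rwa [map_zero, map_zero] at this

end PMap

/-! ### `(1, -1)` is a formal difference law -/

theorem pmOne_isFormalDifferenceLaw : IsFormalDifferenceLaw HZ pmOne where
  p_two := by
    change HZpush (n := 2) (m := 1) (PMap.p 2 1) ![1, -1] =
      fun i : Fin 1 => if 1 = i.succ then 1 else 0
    decide
  s_one_two := by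
    change HZpush (n := 2) (m := 1) (PMap.s 2 0 1 (by decide) 0) ![1, -1] = 0
    decide
  neg_mul := by
    change HZpush (n := 1 * 2) (m := 2) (PMap.cast (Nat.one_mul 2)) (HZmul (n := 1) (m := 2)
      (HZpush (n := 2) (m := 1) (PMap.p 2 0) ![1, -1]) ![1, -1]) =
        HZpush (n := 2) (m := 2) (PMap.perm (Equiv.swap 0 1)) ![1, -1]
    decide
  mul_neg := by
    change HZpush (n := 2 * 1) (m := 2) (PMap.cast (Nat.mul_one 2)) (HZmul (n := 2) (m := 1)
      ![1, -1] (HZpush (n := 2) (m := 1) (PMap.p 2 0) ![1, -1])) =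
        HZpush (n := 2) (m := 2) (PMap.perm (Equiv.swap 0 1)) ![1, -1]
    decide
  perm_pow k π hp hm := by
    change HZpush (PMap.perm π) (pmOnePow k) = pmOnePow k
    -- The only coordinates are `1` and `-1`, so preserving `A_+` and `A_-` means preserving every
    -- coordinate.
    have h : ∀ i, pmOnePow k (π i) = pmOnePow k i := fun i => by
      rcases pmOnePow_eq_one_or k i with h | h
      · exact (hp i h).trans h.symm
      · exact (hm i h).trans h.symm
    refine HZ_ext fun φ h0 => ?_
    rw [HZpush_sum _ _ _ h0]
    simp only [PMap.perm_succ]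
    rw [← Equiv.sum_comp π (fun i => pmOnePow k i * φ i.succ)]
    exact Finset.sum_congr rfl fun i _ => by rw [h]
  s_pow k i j hij l hsign := by
    rw [← HZ.act_comp, ← HZ.act_comp]
    refine HZ_ext (n := 2 ^ k - 1) fun φ h0 => ?_
    refine (HZpush_sum _ (pmOnePow k) _ h0).trans
      (Eq.trans ?_ (HZpush_sum _ (pmOnePow k) _ h0).symm)
    -- The two maps differ only at `i` and `j`. There one has value `0`, while the other contributes
    -- `φ(l)` with opposite signs, which cancels.
    rw [← sub_eq_zero, ← Finset.sum_sub_distrib,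
      ← Finset.sum_subset (Finset.subset_univ {i, j}), Finset.sum_pair hij.ne]
    · rw [PMap.comp_assoc, PMap.d_p_p_apply _ _ _ hij, PMap.d_p_p_apply _ _ _ hij, if_pos (Or.inl rfl),
        if_pos (Or.inr rfl), h0, PMap.s_apply_left, PMap.s_apply_right]
      rcases hsign with ⟨hi, hj⟩ | ⟨hj, hi⟩ <;>
      · rw [mem_Aplus, mem_Aminus] at *
        rw [hi, hj]
        ring
    · intro a _ ha
      rw [PMap.comp_assoc, PMap.d_p_p_apply _ _ _ hij, if_neg, sub_self]
      simpa using ha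

/-- The formal difference law `(1, -1)` in `Hℤ`. -/
def pmOneFDL : FDL HZ := ⟨pmOne, pmOne_isFormalDifferenceLaw⟩

/-! ### Cancellation -/

namespace IsFormalDifferenceLaw

variable {R : DiscreteGammaRing.{u}} {r : R.El 2}

/-- Coordinates of opposite sign with the same image may be sent to the base point. -/
theorem act_erase (hr : IsFormalDifferenceLaw R r) {k n : ℕ} (f : PMap (2 ^ k) n)
    {i j : Fin (2 ^ k)} (hij : i < j)
    (hsign : (i ∈ Aplus k ∧ j ∈ Aminus k) ∨ (j ∈ Aplus k ∧ i ∈ Aminus k))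
    (hf : f.toFun i.succ = f.toFun j.succ) :
    R.act (f.erase i j) (R.pow r k) = R.act f (R.pow r k) := by
  have hi : i.1 < j.1 := hij
  -- Any `l` would do; one exists because `i < j` forces `2^k ≥ 2`.
  let l : Fin (2 ^ k - 1) := ⟨0, by have := j.2; omega⟩
  obtain ⟨g, hg⟩ := f.exists_comp_s_eq i j hij l hf
  -- Write `f = g ∘ s_{i,j,l}`. Then `g ∘ d_l p_i p_j` agrees with `f` off `i`, `j` and kills these
  -- two, so applying `g` to condition 4 gives the claim.
  have h : f.erase i j = g.comp ((PMap.d (2 ^ k - 1) l).comp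
      ((PMap.p (2 ^ k - 1) ⟨i.1, lt_of_lt_of_le hij (Nat.le_sub_one_of_lt j.2)⟩).comp
        (PMap.p (2 ^ k) j))) := by
    refine PMap.ext (funext fun a => ?_)
    rw [PMap.comp_apply, PMap.d_p_p_apply _ _ _ hij, apply_ite g.toFun, g.map_zero, ← PMap.comp_apply, hg]
    rfl
  rw [h, R.act_comp, R.act_comp, R.act_comp, ← hr.s_pow k i j hij l hsign, ← R.act_comp, hg]

end IsFormalDifferenceLaw

/-- A pointed map out of `[2^k]` is reduced if it does not identify coordinates of opposite sign
outside the fibre of the base point. -/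
def PMap.IsReduced {k n : ℕ} (f : PMap (2 ^ k) n) : Prop :=
  ∀ i ∈ Aplus k, ∀ j ∈ Aminus k, f.toFun i.succ = f.toFun j.succ → f.toFun i.succ = 0

/-- Erasing an offending pair strictly lowers the number of elements not sent to the base point, so
the process stops at a reduced map. Each step applies `act_erase` twice, to `r` and to the law `(1,
-1)` in `HZ`, so both pushforwards survive. -/
theorem IsFormalDifferenceLaw.exists_isReduced {R : DiscreteGammaRing.{u}} {r : R.El 2}
    (hr : IsFormalDifferenceLaw R r) {k n : ℕ} (f : PMap (2 ^ k) n) :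
    ∃ g : PMap (2 ^ k) n, g.IsReduced ∧ R.act g (R.pow r k) = R.act f (R.pow r k) ∧
      HZpush g (pmOnePow k) = HZpush f (pmOnePow k) := by
  induction hN : (Finset.univ.filter fun a => f.toFun a ≠ 0).card using Nat.strong_induction_on
    generalizing f with
  | _ N ih =>
  by_cases hf : f.IsReduced
  · exact ⟨f, hf, rfl, rfl⟩
  simp only [PMap.IsReduced, not_forall] at hf
  obtain ⟨i, hi, j, hj, hfij, hf0⟩ := hf
  have hne : i ≠ j := by
    rintro rfl
    rw [mem_Aplus] at hi
    rw [mem_Aminus, hi] at hj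
    omega
  -- The offending pair is put in increasing order, as the indices of `s_{i,j,l}` require.
  obtain ⟨i', j', hij', hsign, hf', hf0'⟩ : ∃ i' j' : Fin (2 ^ k), i' < j' ∧
      ((i' ∈ Aplus k ∧ j' ∈ Aminus k) ∨ (j' ∈ Aplus k ∧ i' ∈ Aminus k)) ∧
      f.toFun i'.succ = f.toFun j'.succ ∧ f.toFun i'.succ ≠ 0 := by
    rcases lt_or_gt_of_ne hne with h | h
    · exact ⟨i, j, h, Or.inl ⟨hi, hj⟩, hfij, hf0⟩
    · exact ⟨j, i, h, Or.inr ⟨hi, hj⟩, hfij.symm, hfij ▸ hf0⟩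
  obtain ⟨g, hg, hg1, hg2⟩ := ih _ (by
    rw [← hN]
    refine Finset.card_lt_card (Finset.ssubset_iff_of_subset ?_ |>.2 ⟨i'.succ, ?_, ?_⟩)
    · intro a
      simp only [Finset.mem_filter_univ, PMap.erase, ne_eq, ite_eq_left_iff, not_forall]
      exact fun ⟨_, h⟩ => h
    · simpa using hf0'
    · simp [PMap.erase]) (f.erase i' j') rfl
  exact ⟨g, hg, hg1.trans (hr.act_erase f hij' hsign hf'),
    hg2.trans (pmOne_isFormalDifferenceLaw.act_erase f hij' hsign hf')⟩

/-! ### Reduced maps are determined up to permutation -/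

theorem HZpush_pmOnePow {k n : ℕ} (f : PMap (2 ^ k) n) (c : Fin n) :
    HZpush f (pmOnePow k) c =
      (Finset.univ.filter fun i => pmOnePow k i = 1 ∧ f.toFun i.succ = c.succ).card -
      ((Finset.univ.filter fun i => pmOnePow k i = -1 ∧ f.toFun i.succ = c.succ).card : ℤ) := by
  rw [Finset.card_filter, Finset.card_filter, Nat.cast_sum, Nat.cast_sum,
    ← Finset.sum_sub_distrib]
  refine Finset.sum_congr rfl fun i _ => ?_
  rcases pmOnePow_eq_one_or k i with h | h <;> by_cases hc : f.toFun i.succ = c.succ <;>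
    simp [h, hc]

theorem PMap.IsReduced.card_eq_zero_or {k n : ℕ} {f : PMap (2 ^ k) n} (hf : f.IsReduced)
    (c : Fin n) :
    (Finset.univ.filter fun i => pmOnePow k i = 1 ∧ f.toFun i.succ = c.succ).card = 0 ∨
    (Finset.univ.filter fun i => pmOnePow k i = -1 ∧ f.toFun i.succ = c.succ).card = 0 := by
  by_contra! h
  simp only [← Nat.pos_iff_ne_zero, Finset.card_pos] at h
  obtain ⟨⟨i, hi⟩, ⟨j, hj⟩⟩ := h
  rw [Finset.mem_filter_univ] at hi hj
  have := hf i hi.1 j hj.1 (hi.2.trans hj.2.symm)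
  rw [hi.2] at this
  exact Fin.succ_ne_zero _ this

/-- The coefficient at `c` is the difference of the numbers of positive and negative coordinates
over `c`; for a reduced map one of the two vanishes, so both are determined. The fibre of the base
point is then determined by counting its complement. Hence the maps (sign, `f`) and (sign, `g`) have
fibres of equal size, and bijections between these assemble to `π`. -/
theorem PMap.IsReduced.exists_perm {k n : ℕ} {f g : PMap (2 ^ k) n} (hf : f.IsReduced)
    (hg : g.IsReduced) (h : HZpush f (pmOnePow k) = HZpush g (pmOnePow k)) :
    ∃ π : Equiv.Perm (Fin (2 ^ k)), (∀ i, pmOnePow k (π i) = pmOnePow k i) ∧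
      g.comp (PMap.perm π) = f := by
  have hsucc : ∀ (s : ℤ) (c : Fin n), s = 1 ∨ s = -1 →
      (Finset.univ.filter fun i => pmOnePow k i = s ∧ f.toFun i.succ = c.succ).card =
      (Finset.univ.filter fun i => pmOnePow k i = s ∧ g.toFun i.succ = c.succ).card := by
    intro s c hs
    have h1 := congrFun h c
    rw [HZpush_pmOnePow, HZpush_pmOnePow] at h1
    have h2 := hf.card_eq_zero_or c
    have h3 := hg.card_eq_zero_or c
    rcases hs with rfl | rfl <;> omega
  -- The total number of coordinates of a given sign does not depend on the map; this yields the
  -- count over the base point, about which the tuple says nothing.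
  have htotal : ∀ (s : ℤ) (f : PMap (2 ^ k) n),
      (Finset.univ.filter fun i => pmOnePow k i = s).card =
      (Finset.univ.filter fun i => pmOnePow k i = s ∧ f.toFun i.succ = 0).card +
      ∑ c : Fin n,
        (Finset.univ.filter fun i => pmOnePow k i = s ∧ f.toFun i.succ = c.succ).card := by
    intro s f
    rw [Finset.card_eq_sum_card_fiberwise (f := fun i => f.toFun i.succ) (t := Finset.univ)
      (fun _ _ => Finset.mem_univ _), Fin.sum_univ_succ]
    simp only [Finset.filter_filter]
  have hcard : ∀ x : ℤ × Fin (n + 1),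
      Fintype.card {i // (pmOnePow k i, f.toFun i.succ) = x} =
      Fintype.card {i // (pmOnePow k i, g.toFun i.succ) = x} := by
    rintro ⟨s, c⟩
    simp only [Fintype.card_subtype, Prod.mk.injEq]
    by_cases hs : s = 1 ∨ s = -1
    · induction c using Fin.cases with
      | zero =>
        have := (htotal s f).symm.trans (htotal s g)
        rwa [Finset.sum_congr rfl fun c _ => hsucc s c hs, Nat.add_right_cancel_iff] at this
      | succ c => exact hsucc s c hs
    · have : ∀ i, pmOnePow k i ≠ s := by
        rintro i rfl
        exact hs (pmOnePow_eq_one_or k i)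
      simp [this]
  let π := Equiv.ofFiberEquiv fun x => Fintype.equivOfCardEq (hcard x)
  have hπ : ∀ i, (pmOnePow k (π i), g.toFun (π i).succ) = (pmOnePow k i, f.toFun i.succ) :=
    fun i => Equiv.ofFiberEquiv_map (f := fun i => (pmOnePow k i, f.toFun i.succ))
      (g := fun i => (pmOnePow k i, g.toFun i.succ)) _ i
  simp only [Prod.mk.injEq] at hπ
  refine ⟨π, fun i => (hπ i).1, PMap.ext (funext fun a => ?_)⟩
  induction a using Fin.cases with
  | zero => rw [PMap.map_zero, PMap.map_zero]
  | succ a => exact (hπ a).2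

/-- The element `f_*(r^k)` depends only on the tuple `f_*((1, -1)^k)`. -/
theorem IsFormalDifferenceLaw.act_pow_eq {R : DiscreteGammaRing.{u}} {r : R.El 2}
    (hr : IsFormalDifferenceLaw R r) {k n : ℕ} {f g : PMap (2 ^ k) n}
    (h : HZpush f (pmOnePow k) = HZpush g (pmOnePow k)) :
    R.act f (R.pow r k) = R.act g (R.pow r k) := by
  obtain ⟨f', hf', hf1, hf2⟩ := hr.exists_isReduced f
  obtain ⟨g', hg', hg1, hg2⟩ := hr.exists_isReduced g
  obtain ⟨π, hπ, hπ'⟩ := hf'.exists_perm hg' (hf2.trans (h.trans hg2.symm))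
  rw [← hf1, ← hg1, ← hπ', R.act_comp, hr.perm_pow k π]
  · exact fun i hi => (hπ i).trans hi
  · exact fun i hi => (hπ i).trans hi

/-! ### Comparison of different powers -/

/-- The pointed map `[2^(k+1)] ⟶ [2^k]` given by `p^2_2` on the last factor. -/
def PMap.dropLast (k : ℕ) : PMap (2 ^ (k + 1)) (2 ^ k) :=
  (PMap.cast (Nat.mul_one (2 ^ k))).comp ((PMap.id (2 ^ k)).smash (PMap.p 2 1))

/-- The pointed map `[2^(k+m)] ⟶ [2^k]` given by `p^2_2` on the last `m` factors. -/
def PMap.drop (k : ℕ) : (m : ℕ) → PMap (2 ^ (k + m)) (2 ^ k)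
  | 0 => PMap.id _
  | m + 1 => (PMap.drop k m).comp (PMap.dropLast (k + m))

namespace IsFormalDifferenceLaw

variable {R : DiscreteGammaRing.{u}} {r : R.El 2}

/-- In `r^(k+1) = r^k r` the map `p^2_2` turns the last factor into `1`. -/
theorem act_dropLast (hr : IsFormalDifferenceLaw R r) (k : ℕ) :
    R.act (PMap.dropLast k) (R.pow r (k + 1)) = R.pow r k := by
  refine (R.act_comp (PMap.cast (Nat.mul_one (2 ^ k))) ((PMap.id (2 ^ k)).smash (PMap.p 2 1))
    (R.mul (R.pow r k) r)).trans ?_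
  rw [R.mul_nat, R.act_id, hr.p_two]
  exact R.mul_one _

theorem act_drop (hr : IsFormalDifferenceLaw R r) (k m : ℕ) :
    R.act (PMap.drop k m) (R.pow r (k + m)) = R.pow r k := by
  induction m with
  | zero => exact R.act_id _
  | succ m ih =>
    rw [PMap.drop, R.act_comp]
    exact (congrArg _ (hr.act_dropLast (k + m))).trans ih

end IsFormalDifferenceLaw

theorem HZpush_comp {n m k : ℕ} (g : PMap m k) (f : PMap n m) (a : Fin n → ℤ) :
    HZpush (g.comp f) a = HZpush g (HZpush f a) :=
  HZ.act_comp g f a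

theorem HZpush_comp_drop {n k : ℕ} (f : PMap (2 ^ k) n) (m : ℕ) :
    HZpush (f.comp (PMap.drop k m)) (pmOnePow (k + m)) = HZpush f (pmOnePow k) :=
  (HZpush_comp _ _ _).trans (congrArg (HZpush f) (pmOne_isFormalDifferenceLaw.act_drop k m))

/-- Precomposing the map from the lower power with `PMap.drop` changes neither its value on `r` nor
its tuple, and reduces to equal exponents. -/
theorem IsFormalDifferenceLaw.act_pow_eq_act_pow {R : DiscreteGammaRing.{u}} {r : R.El 2}
    (hr : IsFormalDifferenceLaw R r) {k l n : ℕ} {f : PMap (2 ^ k) n} {g : PMap (2 ^ l) n}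
    (h : HZpush f (pmOnePow k) = HZpush g (pmOnePow l)) :
    R.act f (R.pow r k) = R.act g (R.pow r l) := by
  wlog hkl : k ≤ l generalizing k l
  · exact (this h.symm (le_of_not_ge hkl)).symm
  obtain ⟨m, rfl⟩ := Nat.exists_eq_add_of_le hkl
  rw [← hr.act_drop k m, ← R.act_comp]
  exact hr.act_pow_eq ((HZpush_comp_drop f m).trans h)

/-! ### All tuples come from powers of `(1, -1)` -/

/-- The map `[2^(k+1)] ⟶ [n]` given by `f` and `g` on the coordinates whose last index is
`1` and `2`. -/
def PMap.glue {k n : ℕ} (f g : PMap (2 ^ k) n) : PMap (2 ^ (k + 1)) n :=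
  ⟨Fin.cases 0 fun c => if ((smashEquiv (2 ^ k) 2).symm c).2 = 0
    then f.toFun ((smashEquiv (2 ^ k) 2).symm c).1.succ
    else g.toFun ((smashEquiv (2 ^ k) 2).symm c).1.succ, rfl⟩

theorem PMap.glue_smashIdx {k n : ℕ} (f g : PMap (2 ^ k) n) (i : Fin (2 ^ k)) (j : Fin 2) :
    (f.glue g).toFun (smashIdx (2 ^ k) 2 i.succ j.succ) =
      if j = 0 then f.toFun i.succ else g.toFun i.succ := by
  rw [smashIdx_succ]
  change (if ((smashEquiv (2 ^ k) 2).symm (smashEquiv (2 ^ k) 2 (i, j))).2 = 0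
    then f.toFun ((smashEquiv (2 ^ k) 2).symm (smashEquiv (2 ^ k) 2 (i, j))).1.succ
    else g.toFun ((smashEquiv (2 ^ k) 2).symm (smashEquiv (2 ^ k) 2 (i, j))).1.succ) = _
  rw [Equiv.symm_apply_apply]

/-- The coordinates of `(1, -1)^(k+1)` with last index `1` form a copy of `(1, -1)^k`, and those
with last index `2` its negative. So gluing realizes subtraction. -/
theorem HZpush_glue {k n : ℕ} (f g : PMap (2 ^ k) n) :
    HZpush (f.glue g) (pmOnePow (k + 1)) =
      HZpush f (pmOnePow k) - HZpush g (pmOnePow k) := by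
  refine HZ_ext fun φ h0 => ?_
  refine (HZpush_sum (f.glue g) _ φ h0).trans ?_
  refine (HZmul_sum (n := 2 ^ k) (m := 2) (pmOnePow k) ![1, -1]
    (fun t => φ ((f.glue g).toFun t))).trans ?_
  simp only [PMap.glue_smashIdx, Pi.sub_apply, sub_mul, Finset.sum_sub_distrib,
    HZpush_sum _ _ _ h0, Fin.sum_univ_two]
  rw [← Finset.sum_sub_distrib]
  refine Finset.sum_congr rfl fun i _ => ?_
  simp
  ring

/-- The tuples of the form `f_*((1, -1)^k)`. -/
def HZpushSubgroup (n : ℕ) : AddSubgroup (Fin n → ℤ) :=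
  AddSubgroup.ofSub {x | ∃ (k : ℕ) (f : PMap (2 ^ k) n), HZpush f (pmOnePow k) = x}
    ⟨_, 0, ⟨fun _ => 0, rfl⟩, rfl⟩ (by
      rintro _ ⟨k, f, rfl⟩ _ ⟨l, g, rfl⟩
      -- Gluing needs a common exponent, so the smaller one is raised by `PMap.drop`.
      obtain ⟨K, f', g', hf, hg⟩ : ∃ (K : ℕ) (f' g' : PMap (2 ^ K) n),
          HZpush f' (pmOnePow K) = HZpush f (pmOnePow k) ∧
          HZpush g' (pmOnePow K) = HZpush g (pmOnePow l) := by
        rcases le_total k l with h | h <;> obtain ⟨m, rfl⟩ := Nat.exists_eq_add_of_le h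
        · exact ⟨_, _, g, HZpush_comp_drop f m, rfl⟩
        · exact ⟨_, f, _, rfl, HZpush_comp_drop g m⟩
      refine ⟨K + 1, f'.glue g', ?_⟩
      rw [HZpush_glue, hf, hg, sub_eq_add_neg])

/-- Tuples of this form are closed under subtraction, and the basis vectors are among them: `(1,
-1)^0 = 1` is pushed forward along the map `[1] ⟶ [n]` that hits `i`. -/
theorem exists_HZpush_eq {n : ℕ} (x : Fin n → ℤ) :
    ∃ (k : ℕ) (f : PMap (2 ^ k) n), HZpush f (pmOnePow k) = x := by
  suffices h : x ∈ HZpushSubgroup n from h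
  have hx : x = ∑ i, x i • (Pi.single i 1 : Fin n → ℤ) := by
    funext j
    simp [Finset.sum_apply, Pi.single_apply]
  rw [hx]
  refine sum_mem fun i _ => zsmul_mem ?_ _
  refine ⟨0, ⟨Fin.cases 0 fun _ => i.succ, rfl⟩, ?_⟩
  funext j
  change ∑ t : Fin 1, (if i.succ = j.succ then (1 : ℤ) else 0) = _
  simp [Pi.single_apply, eq_comm]

/-! ### The multiplicative map of a formal difference law -/

namespace DiscreteGammaRing

theorem pow_mul_pow (R : DiscreteGammaRing.{u}) {n : ℕ} (x : R.El n) (k l : ℕ) :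
    R.mul (R.pow x k) (R.pow x l) = R.act (PMap.cast (pow_add n k l)) (R.pow x (k + l)) := by
  induction l with
  | zero =>
    have h := R.mul_one (R.pow x k)
    have h' := congrArg (R.act (PMap.cast (Nat.mul_one (n ^ k)).symm)) h
    rw [act_cast_cast, act_cast_rfl] at h'
    exact h'
  | succ l ih =>
    change R.mul (R.pow x k) (R.mul (R.pow x l) x) = R.act _ (R.mul (R.pow x (k + l)) x)
    rw [← R.mul_assoc, ih, mul_cast_left, act_cast_cast]
    rfl

end DiscreteGammaRing

namespace FDL

variable {R : DiscreteGammaRing.{u}} (r : FDL R)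

/-- The value `f_*(r^k)` at a tuple `f_*((1, -1)^k)`. -/
noncomputable def homApp {n : ℕ} (x : Fin n → ℤ) : R.El n :=
  R.act (exists_HZpush_eq x).choose_spec.choose (R.pow r.1 (exists_HZpush_eq x).choose)

/-- The value does not depend on the chosen presentation; all properties of the map below are
checked on whichever presentation is convenient. -/
theorem homApp_HZpush {k n : ℕ} (f : PMap (2 ^ k) n) :
    r.homApp (HZpush f (pmOnePow k)) = R.act f (R.pow r.1 k) :=
  r.2.act_pow_eq_act_pow (exists_HZpush_eq _).choose_spec.choose_spec

/-- The multiplicative map `Hℤ → R` which sends `f_*((1, -1)^k)` to `f_*(r^k)`. -/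
noncomputable def toHom : DiscreteGammaRing.Hom HZ R where
  app n x := r.homApp (n := n) x
  app_pt n := by
    -- The zero tuple is presented by a map through `[0]`; since `R[0]` is a point, its value is the
    -- base point.
    have h := r.homApp_HZpush (k := 0) (n := n) ((⟨fun _ => 0, rfl⟩ : PMap 0 n).comp
      (⟨fun _ => 0, rfl⟩ : PMap (2 ^ 0) 0))
    rw [R.act_comp, R.zero.elim (R.act _ _) (R.pt 0), R.act_pt] at h
    refine Eq.trans (congrArg r.homApp ?_) h
    funext j
    exact (Finset.sum_eq_zero fun i _ => if_neg (Fin.succ_ne_zero j).symm).symm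
  app_act {n m} f x := by
    obtain ⟨k, g, rfl⟩ := exists_HZpush_eq (n := n) x
    rw [homApp_HZpush, ← R.act_comp, ← homApp_HZpush, HZpush_comp]
    rfl
  app_unit n a := by
    -- A generator is the image of `1 = r^0` under the map `[1] ⟶ [n]` with value `a`, so naturality
    -- of the unit suffices.
    let f : PMap (2 ^ 0) n := ⟨Fin.cases 0 fun _ => a, rfl⟩
    have h := r.homApp_HZpush f
    have h1 : HZpush f (pmOnePow 0) = HZ.unit n a := HZ.unit_nat (n := 1) f 1
    rw [h1] at h
    exact h.trans (R.unit_nat (n := 1) f 1)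
  app_mul {n m} x y := by
    obtain ⟨k, f, rfl⟩ := exists_HZpush_eq (n := n) x
    obtain ⟨l, g, rfl⟩ := exists_HZpush_eq (n := m) y
    -- The product of `f_*(z^k)` and `g_*(z^l)` is `(f ∧ g)_*(z^(k+l))`. The same formula for `(1,
    -- -1)` in `HZ` presents the product tuple by the same map.
    have h : ∀ {R : DiscreteGammaRing.{u}} (z : R.El 2),
        R.mul (R.act f (R.pow z k)) (R.act g (R.pow z l)) =
          R.act ((f.smash g).comp (PMap.cast (pow_add 2 k l))) (R.pow z (k + l)) := by
      intro R z
      rw [← R.mul_nat, R.pow_mul_pow, R.act_comp]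
    have hZ : HZ.mul (HZ.act f (HZ.pow pmOne k)) (HZ.act g (HZ.pow pmOne l)) =
        HZ.act ((f.smash g).comp (PMap.cast (pow_add 2 k l))) (HZ.pow pmOne (k + l)) := by
      rw [← HZ.mul_nat, HZ.pow_mul_pow, HZ.act_comp]
    rw [homApp_HZpush, homApp_HZpush, h, ← homApp_HZpush]
    exact congrArg r.homApp hZ

theorem toHom_pmOne : r.toHom.app 2 pmOne = r.1 := by
  have h : ∀ {R : DiscreteGammaRing.{u}} (z : R.El 2),
      R.act (PMap.cast (pow_one 2)) (R.pow z 1) = z :=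
    fun z => DiscreteGammaRing.one_mul _ z
  have hZ : HZ.act (PMap.cast (pow_one 2)) (HZ.pow pmOne 1) = pmOne := HZ.one_mul pmOne
  refine Eq.trans ?_ ((r.homApp_HZpush (k := 1) (PMap.cast (pow_one 2))).trans (h r.1))
  exact (congrArg r.homApp hZ).symm

end FDL

/-- A multiplicative map out of `Hℤ` is determined by its value at `(1, -1)`. -/
theorem DiscreteGammaRing.Hom.ext_pmOne {R : DiscreteGammaRing.{u}}
    {φ ψ : DiscreteGammaRing.Hom HZ R} (h : φ.app 2 pmOne = ψ.app 2 pmOne) : φ = ψ := by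
  ext n x
  obtain ⟨k, f, rfl⟩ := exists_HZpush_eq (n := n) x
  change φ.app n (HZ.act f (HZ.pow pmOne k)) = ψ.app n (HZ.act f (HZ.pow pmOne k))
  rw [φ.app_act, ψ.app_act, φ.app_pow, ψ.app_pow, h]

/-- Formal difference laws in `R` correspond to multiplicative maps `Hℤ → R`. -/
noncomputable def multMapEquivFDL (R : DiscreteGammaRing.{u}) :
    DiscreteGammaRing.Hom HZ R ≃ FDL R where
  toFun φ := φ.mapFDL pmOneFDL
  invFun r := r.toHom
  left_inv φ := DiscreteGammaRing.Hom.ext_pmOne (FDL.toHom_pmOne (φ.mapFDL pmOneFDL))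
  right_inv r := Subtype.ext r.toHom_pmOne

/-! ### Homotopy orbits -/

namespace SimplicialAction

variable {G : SimplicialObject GrpCat.{u}} {X Y : SSet.{u}}

/-- An equivariant isomorphism of simplicial sets induces an isomorphism of homotopy orbits. -/
def homotopyOrbitsIso (A : SimplicialAction G X) (B : SimplicialAction G Y)
    (E : ∀ d, X.obj d ≃ Y.obj d)
    (hmap : ∀ {d e : SimplexCategoryᵒᵖ} (θ : d ⟶ e) (x : X.obj d),
      E e (X.map θ x) = Y.map θ (E d x))
    (hsmul : ∀ {d : SimplexCategoryᵒᵖ} (g : G.obj d) (x : X.obj d),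
      E d (A.smul g x) = B.smul g (E d x)) :
    A.homotopyOrbits ≅ B.homotopyOrbits :=
  NatIso.ofComponents
    (fun d => Equiv.toIso (Quotient.congr (ra := A.diagonal.orbitSetoid d)
      (rb := B.diagonal.orbitSetoid d) ((Equiv.refl _).prodCongr (E d)) (by
        rintro ⟨h, x⟩ ⟨h', x'⟩
        -- By equivariance the same `g` relates the two pairs on either side.
        refine exists_congr fun g => ?_
        change ((fun i => g * h i, A.smul g x) : _ × _) = (h', x') ↔
          ((fun i => g * h i, B.smul g (E d x)) : _ × _) = (h', E d x')
        rw [Prod.mk.injEq, Prod.mk.injEq, ← hsmul, (E d).apply_eq_iff_eq])))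
    (by
      intro d e θ
      ext z
      induction z using Quotient.inductionOn with | _ z => ?_
      exact congrArg (fun y => B.homotopyOrbitMk (fun i => G.map θ (z.1 (θ.unop.toOrderHom i))) y)
        (hmap θ z.2))

end SimplicialAction

theorem theorem3p9 (R : GammaRing.{u}) :
    ∃ e : R.fdlConj.homotopyOrbits ≅ R.multMapsConj.homotopyOrbits,
      ∀ (d : SimplexCategoryᵒᵖ) (h : Fin (d.unop.len + 1) → R.unitGroup.obj d)
        (r : FDL (R.ringLevel d)),
        ∃ φ : DiscreteGammaRing.Hom HZ (R.ringLevel d),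
          φ.app 2 pmOne = r.1 ∧
            e.hom.app d (R.fdlConj.homotopyOrbitMk h r) = R.multMapsConj.homotopyOrbitMk h φ :=
  -- The isomorphism is built from multiplicative maps to laws and then inverted: in that direction
  -- it is evaluation at `(1, -1)`, for which both compatibilities hold by definition.
  ⟨(SimplicialAction.homotopyOrbitsIso R.multMapsConj R.fdlConj
      (fun d => multMapEquivFDL (R.ringLevel d)) (fun _ _ => rfl) (fun _ _ => rfl)).symm,
    fun _ _ r => ⟨r.toHom, r.toHom_pmOne, rfl⟩⟩
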